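/- Let $\mathcal Y$ be a complex Hilbert space, let $M$ be a bounded positive (i.e. $(Mx,x)\ge 0$) selfadjoint operator on $\mathcal Y$, and let $C,\hat C$ be bounded accretive operators on $\mathcal Y$ (i.e. $\Re(Cx,x)\ge 0$ and $\Re(\hat Cx,x)\ge 0$ for all $x$) such that for some $\varepsilon>0$ $$\big|((\hat C-C)x,y)\big|^2\le\varepsilon^2\,\Re(Cy,y)\,\Re(\hat Cx,x)\qquad\text{for all }x,y\in\mathcal Y.$$ On $\mathcal Y\oplus\mathcal Y$ consider the bounded operators $$\mathcal A^+=\begin{pmatrix}-C&-M^{1/2}\\ M^{1/2}&0\end{pmatrix},\qquad \hat{\mathcal A}^+=\begin{pmatrix}-\hat C&-M^{1/2}\\ M^{1/2}&0\end{pmatrix}.$$ Then $\mathcal A^+$ and $\hat{\mathcal A}^+$ have the same null-space. Let $\mathcal X$ be the orthogonal complement of this null-space, and let $\mathcal A$, $\hat{\mathcal A}$ be the (in general unbounded) operators in $\mathcal X$ that are the inverses of the parts of $\mathcal A^+$, $\hat{\mathcal A}^+$ in $\mathcal X$. Then $\mathcal A$ and $\hat{\mathcal A}$ generate strongly continuous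 contraction semigroups $e^{\mathcal At}$, $e^{\hat{\mathcal A}t}$ on $\mathcal X$. Moreover, there are dense subspaces $\mathcal D\subseteq\mathcal D(\hat{\mathcal A}^*)$ and $\mathcal E\subseteq\mathcal D(\mathcal A)$ of $\mathcal X$, invariant under $e^{\hat{\mathcal A}^*t}=(e^{\hat{\mathcal A}t})^*$ and $e^{\mathcal At}$ $(t\ge0)$ respectively, such that for all $x\in\mathcal D$, $y\in\mathcal E$ one has $\Re(-\hat{\mathcal A}^*x,x)\ge0$, $\Re(-\mathcal Ay,y)\ge0$ and $$\big|(\hat{\mathcal A}^*x,y)-(x,\mathcal Ay)\big|^2\le\varepsilon^2\,\Re(-\hat{\mathcal A}^*x,x)\,\Re(-\mathcal Ay,y),$$ and $$\|e^{\hat{\mathcal A}t}-e^{\mathcal At}\|\le\frac{\varepsilon}{2}\qquad\text{for all }t\ge0.$$ -/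

import Mathlib

open Filter Topology
open scoped NNReal InnerProductSpace

noncomputable section

/-- A strongly continuous one-parameter semigroup of bounded operators on `X`. -/
structure C0Semigroup (X : Type*) [NormedAddCommGroup X] [NormedSpace ℂ X] where
  /-- the operator at time `t` -/
  op : ℝ≥0 → X →L[ℂ] X
  op_zero : op 0 = 1
  op_add : ∀ s t, op (s + t) = op s ∘L op t
  continuous_orbit : ∀ x, Continuous fun t => op t x

/-- `A` is the (infinitesimal) generator of `T`: one has `x ∈ D(A)` and `A x = y` exactly when
`(T(t) x - x) / t` tends to `y` as `t` decreases to `0`. -/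
def C0Semigroup.HasGenerator {X : Type*} [NormedAddCommGroup X] [NormedSpace ℂ X]
    (T : C0Semigroup X) (A : X →ₗ.[ℂ] X) : Prop :=
  ∀ x y : X, (x, y) ∈ A.graph ↔
    Tendsto (fun t : ℝ≥0 => (((t : ℝ) : ℂ))⁻¹ • (T.op t x - x)) (𝓝[>] 0) (𝓝 y)

/-- All the operators of the semigroup are contractions. -/
def C0Semigroup.IsContractive {X : Type*} [NormedAddCommGroup X] [NormedSpace ℂ X]
    (T : C0Semigroup X) : Prop :=
  ∀ t, ‖T.op t‖ ≤ 1

/-- `A` and `B` generate the strongly continuous semigroups `T` (`= e^{At}`) and `S` (`= e^{Bt}`),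
and there are dense subspaces `D ⊆ D(B*)`, `E ⊆ D(A)`, invariant under `e^{B* t} = (e^{Bt})*`
and `e^{At}` respectively, such that for all `x ∈ D`, `y ∈ E`
`|(B* x, y) - (x, A y)|² ≤ ε² Re(-B* x, x) Re(-A y, y)`,
both factors on the right being non-negative. -/
def FormBoundedPair {X : Type*} [NormedAddCommGroup X] [InnerProductSpace ℂ X] [CompleteSpace X]
    (A B : X →ₗ.[ℂ] X) (T S : C0Semigroup X) (ε : ℝ) : Prop :=
  T.HasGenerator A ∧ S.HasGenerator B ∧
  ∃ D E : Submodule ℂ X,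
    D ≤ B.adjoint.domain ∧ E ≤ A.domain ∧
    Dense (D : Set X) ∧ Dense (E : Set X) ∧
    (∀ t, ∀ x ∈ D, ContinuousLinearMap.adjoint (S.op t) x ∈ D) ∧
    (∀ t, ∀ y ∈ E, T.op t y ∈ E) ∧
    ∀ x : B.adjoint.domain, (x : X) ∈ D → ∀ y : A.domain, (y : X) ∈ E →
      0 ≤ (⟪-(B.adjoint x), (x : X)⟫_ℂ).re ∧
      0 ≤ (⟪-(A y), (y : X)⟫_ℂ).re ∧
      ‖⟪B.adjoint x, (y : X)⟫_ℂ - ⟪(x : X), A y⟫_ℂ‖ ^ 2 ≤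
        ε ^ 2 * (⟪-(B.adjoint x), (x : X)⟫_ℂ).re * (⟪-(A y), (y : X)⟫_ℂ).re

/-- The operator with matrix `[[a, b], [c, d]]` on the Hilbert space sum `Y ⊕ Y`. -/
def blockOp {Y : Type*} [NormedAddCommGroup Y] [InnerProductSpace ℂ Y] (a b c d : Y →L[ℂ] Y) :
    WithLp 2 (Y × Y) →L[ℂ] WithLp 2 (Y × Y) :=
  (WithLp.prodContinuousLinearEquiv 2 ℂ Y Y).symm.toContinuousLinearMap ∘L
    ((a.coprod b).prod (c.coprod d)) ∘L
    (WithLp.prodContinuousLinearEquiv 2 ℂ Y Y).toContinuousLinearMap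

/-- `𝒜⁺ = [[-C, -M^{1/2}], [M^{1/2}, 0]]` on `Y ⊕ Y`, with `M^{1/2}` the positive square root. -/
def phaseOp {Y : Type*} [NormedAddCommGroup Y] [InnerProductSpace ℂ Y] [CompleteSpace Y]
    (M C : Y →L[ℂ] Y) : WithLp 2 (Y × Y) →L[ℂ] WithLp 2 (Y × Y) :=
  blockOp (-C) (-CFC.sqrt M) (CFC.sqrt M) 0

/-- The physical phase space `𝒳 = N(𝒜⁺)^⊥`. -/
abbrev physSpace {Y : Type*} [NormedAddCommGroup Y] [InnerProductSpace ℂ Y] [CompleteSpace Y]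
    (M C : Y →L[ℂ] Y) : Submodule ℂ (WithLp 2 (Y × Y)) :=
  (LinearMap.ker (phaseOp M C).toLinearMap)ᗮ

/-- The part of the operator `B` in the subspace `K`: its domain is `{x ∈ K | B x ∈ K}`. -/
def partIn {H : Type*} [NormedAddCommGroup H] [InnerProductSpace ℂ H]
    (B : H →L[ℂ] H) (K : Submodule ℂ H) : K →ₗ.[ℂ] K where
  domain := (K.comap B.toLinearMap).comap K.subtype
  toFun := ((B.toLinearMap ∘ₗ K.subtype) ∘ₗ Submodule.subtype _).codRestrict K fun x => x.2

/-- The inverse of the part of `𝒜⁺` (for the coefficients `M`, `C`) in the subspace `K`, as an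
operator in `K` with domain the range of that part. For `K = 𝒳`, where the part is injective, it
is the generator `𝒜`. -/
def phaseGen {Y : Type*} [NormedAddCommGroup Y] [InnerProductSpace ℂ Y] [CompleteSpace Y]
    (M C : Y →L[ℂ] Y) (K : Submodule ℂ (WithLp 2 (Y × Y))) : K →ₗ.[ℂ] K :=
  (partIn (phaseOp M C) K).inverse

end

/-! The argument works with the bounded inverses of the generators. The range of a bounded
dissipative operator is orthogonal to its kernel, so `phaseOp M C` and `phaseOp M C'` restrict to
bounded dissipative operators B, B' on the common phase space, injective with dense range; the
generators are B⁻¹ and B'⁻¹. The Yosida approximations (B - δ)⁻¹ yield the contraction semigroups as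
δ → 0 (`exists_contractive_generatedByInverse`).

B and B' differ only in the damping block. With x = B'*u and y = Bv the form bound becomes |⟨u, (B -
B')v⟩|² ≤ ε² Re⟨-B'u, u⟩ Re⟨-Bv, v⟩, which is the hypothesis with C and C' exchanged on the right;
`accretive_form_bound_swap` shows that this exchange costs nothing in ε.

For the norm estimate let S = (T')*. The derivative of s ↦ Re⟨S(s)x, T(t-s)y⟩ is the form
difference, at most ε/2 times the sum of the two dissipation rates by AM-GM. These rates are half
the derivatives of -‖S(s)x‖² and ‖T(t-s)y‖², so integration leaves ε/4 (‖x‖² + ‖y‖²)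
(`re_inner_sub_le_of_forall_form_bound`), and scaling turns this into ε/2 ‖x‖‖y‖. -/

noncomputable section

/-! ### Bounded dissipative operators, their Yosida approximations and exponentials. -/

section DissipativeOperators

variable {X : Type*} [NormedAddCommGroup X] [InnerProductSpace ℂ X]

/-- A bounded operator with non-positive real part. -/
def DissipativeCLM (B : X →L[ℂ] X) : Prop := ∀ x, (⟪B x, x⟫_ℂ).re ≤ 0

theorem hasDerivAt_re_inner {f g : ℝ → X} {f' g' : X} {t : ℝ} (hf : HasDerivAt f f' t)
    (hg : HasDerivAt g g' t) :
    HasDerivAt (fun s => (⟪f s, g s⟫_ℂ).re) ((⟪f t, g'⟫_ℂ).re + (⟪f', g t⟫_ℂ).re) t := by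
  have h := Complex.reCLM.hasFDerivAt.comp_hasDerivAt t (HasDerivAt.inner ℂ hf hg)
  simpa using! h

theorem DissipativeCLM.norm_le {B : X →L[ℂ] X} (hB : DissipativeCLM B) (δ : ℝ) (x : X) :
    δ * ‖x‖ ≤ ‖B x - (δ : ℂ) • x‖ := by
  rcases eq_or_ne x 0 with rfl | hx
  · simp
  have h1 : δ * ‖x‖ ^ 2 ≤ (⟪(δ : ℂ) • x - B x, x⟫_ℂ).re := by
    have := hB x
    rw [inner_sub_left, inner_smul_left, inner_self_eq_norm_sq_to_K]
    simp only [Complex.sub_re, Complex.conj_ofReal, Complex.coe_algebraMap, ← Complex.ofReal_pow,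
      ← Complex.ofReal_mul, Complex.ofReal_re]
    linarith
  have h2 := (Complex.re_le_norm _).trans (norm_inner_le_norm (𝕜 := ℂ) ((δ : ℂ) • x - B x) x)
  rw [norm_sub_rev] at h2
  have hx' : 0 < ‖x‖ := norm_pos_iff.mpr hx
  nlinarith

variable [CompleteSpace X]

theorem DissipativeCLM.isUnit_sub {B : X →L[ℂ] X} (hB : DissipativeCLM B) {δ : ℝ} (hδ : 0 < δ) :
    IsUnit (B - (δ : ℂ) • (1 : X →L[ℂ] X)) := by
  refine ContinuousLinearMap.isUnit_of_forall_le_norm_inner_map _ (c := ⟨δ, hδ.le⟩) hδ fun x => ?_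
  have := hB x
  change ‖x‖ ^ 2 * δ ≤ _
  refine le_trans ?_ ((neg_le_abs _).trans (Complex.abs_re_le_norm _))
  simp only [sub_apply, smul_apply, inner_sub_left,
    one_apply_eq_self, inner_smul_left, inner_self_eq_norm_sq_to_K,
    Complex.sub_re, Complex.conj_ofReal, Complex.coe_algebraMap, ← Complex.ofReal_pow,
      ← Complex.ofReal_mul, Complex.ofReal_re]
  linarith

/-- The Yosida approximation `(B - δ)⁻¹` of the inverse of `B`. -/
def yosida (B : X →L[ℂ] X) (δ : ℝ) : X →L[ℂ] X := Ring.inverse (B - (δ : ℂ) • (1 : X →L[ℂ] X))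

omit [CompleteSpace X] in
theorem commute_yosida_yosida (B : X →L[ℂ] X) (δ η : ℝ) :
    Commute (yosida B δ) (yosida B η) := by
  refine Commute.ringInverse_ringInverse ?_
  exact ((Commute.refl B).sub_right ((Commute.one_right _).smul_right _)).sub_left
    (((Commute.one_left B).sub_right ((Commute.one_left _).smul_right _)).smul_left _)

namespace DissipativeCLM

variable {B : X →L[ℂ] X} (hB : DissipativeCLM B) {δ : ℝ} (hδ : 0 < δ)
include hB hδ

theorem yosida_apply_sub (x : X) : yosida B δ (B x - (δ : ℂ) • x) = x := by
  have := Ring.inverse_mul_cancel _ (hB.isUnit_sub hδ)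
  exact DFunLike.congr_fun this x

theorem sub_apply_yosida (x : X) : B (yosida B δ x) - (δ : ℂ) • yosida B δ x = x := by
  have := Ring.mul_inverse_cancel _ (hB.isUnit_sub hδ)
  exact DFunLike.congr_fun this x

theorem yosida_apply (x : X) : yosida B δ (B x) = x + (δ : ℂ) • yosida B δ x := by
  have := hB.yosida_apply_sub hδ x
  rw [map_sub, map_smul] at this
  rw [← sub_eq_iff_eq_add, this]

theorem apply_yosida (x : X) : B (yosida B δ x) = x + (δ : ℂ) • yosida B δ x := by
  rw [← sub_eq_iff_eq_add, hB.sub_apply_yosida hδ]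

theorem commute_yosida : Commute B (yosida B δ) := by
  ext x
  simp [hB.apply_yosida hδ, hB.yosida_apply hδ]

theorem dissipative_yosida : DissipativeCLM (yosida B δ) := by
  intro x
  have h := hB (yosida B δ x)
  rw [hB.apply_yosida hδ, inner_add_left, inner_smul_left, inner_self_eq_norm_sq_to_K] at h
  simp only [Complex.add_re, Complex.conj_ofReal, Complex.coe_algebraMap, ← Complex.ofReal_pow,
      ← Complex.ofReal_mul, Complex.ofReal_re] at h
  rw [← inner_conj_symm, Complex.conj_re]
  nlinarith [sq_nonneg ‖yosida B δ x‖]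

theorem norm_smul_yosida_le (x : X) : ‖(δ : ℂ) • yosida B δ x‖ ≤ ‖x‖ := by
  have := hB.norm_le δ (yosida B δ x)
  rw [hB.sub_apply_yosida hδ] at this
  rwa [norm_smul, Complex.norm_real, Real.norm_of_nonneg hδ.le]

/-- On B²x the inverse of B takes the value Bx, and the error of the approximation is δ(x + δ(B -
δ)⁻¹x), hence O(δ). -/
theorem norm_yosida_sub_le (x : X) :
    ‖yosida B δ (B (B x)) - B x‖ ≤ 2 * δ * ‖x‖ := by
  rw [hB.yosida_apply hδ, add_sub_cancel_left, hB.yosida_apply hδ, norm_smul, Complex.norm_real,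
    Real.norm_of_nonneg hδ.le]
  nlinarith [norm_add_le x ((δ : ℂ) • yosida B δ x), hB.norm_smul_yosida_le hδ x]

end DissipativeCLM

theorem hasDerivAt_exp_apply (A : X →L[ℂ] X) (x : X) (t : ℝ) :
    HasDerivAt (fun s : ℝ => NormedSpace.exp ((s : ℂ) • A) x)
      (NormedSpace.exp ((t : ℂ) • A) (A x)) t := by
  have h := (hasDerivAt_exp_smul_const (𝕂 := ℂ) A (t : ℂ)).clm_apply (hasDerivAt_const (t : ℂ) x)
  simpa using! h.scomp t Complex.ofRealCLM.hasDerivAt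

omit [CompleteSpace X] in
theorem norm_le_norm_of_re_inner_deriv_nonpos {f f' : ℝ → X}
    (hd : ∀ t, HasDerivAt f (f' t) t) (h : ∀ t, (⟪f' t, f t⟫_ℂ).re ≤ 0) {t : ℝ} (ht : 0 ≤ t) :
    ‖f t‖ ≤ ‖f 0‖ := by
  have hd' := fun t => hasDerivAt_re_inner (hd t) (hd t)
  have hanti : Antitone fun s => (⟪f s, f s⟫_ℂ).re := by
    refine antitone_of_deriv_nonpos (fun t => (hd' t).differentiableAt) fun t => ?_
    rw [(hd' t).deriv, ← inner_conj_symm, Complex.conj_re]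
    linarith [h t]
  have := hanti ht
  simp only [inner_self_eq_norm_sq_to_K, Complex.coe_algebraMap, ← Complex.ofReal_pow,
    Complex.ofReal_re] at this
  exact le_of_sq_le_sq this (norm_nonneg _)

theorem exp_apply_comm {A B : X →L[ℂ] X} (h : Commute A B) (c : ℂ) (x : X) :
    NormedSpace.exp (c • A) (B x) = B (NormedSpace.exp (c • A) x) :=
  DFunLike.congr_fun ((h.smul_left c).exp_left.eq) x

theorem DissipativeCLM.norm_exp_apply_le {A : X →L[ℂ] X} (hA : DissipativeCLM A) {t : ℝ}
    (ht : 0 ≤ t) (x : X) : ‖NormedSpace.exp ((t : ℂ) • A) x‖ ≤ ‖x‖ := by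
  have := norm_le_norm_of_re_inner_deriv_nonpos (hasDerivAt_exp_apply A x)
    (fun t => by rw [exp_apply_comm (Commute.refl A)]; exact hA _) ht
  simpa using this

/-- The path e^{sA} e^{(t-s)A'} x joins the two vectors; for 0 ≤ s ≤ t both factors are
contractions, so its speed is at most ‖Ax - A'x‖. -/
theorem DissipativeCLM.norm_exp_sub_le {A A' : X →L[ℂ] X} (hA : DissipativeCLM A)
    (hA' : DissipativeCLM A') (hc : Commute A A') {t : ℝ} (ht : 0 ≤ t) (x : X) :
    ‖NormedSpace.exp ((t : ℂ) • A) x - NormedSpace.exp ((t : ℂ) • A') x‖ ≤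
      ‖A x - A' x‖ * t := by
  let _ : NormedAlgebra ℚ (X →L[ℂ] X) := NormedAlgebra.restrictScalars ℚ ℂ (X →L[ℂ] X)
  have hprod : ∀ s : ℝ, NormedSpace.exp ((s : ℂ) • A) * NormedSpace.exp (((t - s : ℝ) : ℂ) • A') =
      NormedSpace.exp ((t : ℂ) • A') * NormedSpace.exp ((s : ℂ) • (A - A')) := by
    intro s
    rw [← NormedSpace.exp_add_of_commute ((hc.smul_left _).smul_right _),
      ← NormedSpace.exp_add_of_commute]
    · congr 1
      push_cast
      module
    · exact ((hc.symm.sub_right (Commute.refl _)).smul_left _).smul_right _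
  have hd : ∀ s ∈ Set.Icc (0 : ℝ) t, HasDerivWithinAt
      (fun s : ℝ => NormedSpace.exp ((t : ℂ) • A') (NormedSpace.exp ((s : ℂ) • (A - A')) x))
      (NormedSpace.exp ((t : ℂ) • A') (NormedSpace.exp ((s : ℂ) • (A - A')) ((A - A') x)))
      (Set.Icc 0 t) s := by
    intro s _
    exact (((NormedSpace.exp ((t : ℂ) • A')).restrictScalars ℝ).hasFDerivAt.comp_hasDerivAt s
      (hasDerivAt_exp_apply (A - A') x s)).hasDerivWithinAt
  have := norm_image_sub_le_of_norm_deriv_le_segment' hd (C := ‖A x - A' x‖) (fun s hs => by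
    have h := DFunLike.congr_fun (hprod s) ((A - A') x)
    rw [mul_apply_eq_comp, mul_apply_eq_comp] at h
    rw [← h]
    exact (hA.norm_exp_apply_le hs.1 _).trans
      (hA'.norm_exp_apply_le (sub_nonneg.mpr hs.2.le) _)) t (Set.right_mem_Icc.mpr ht)
  have h := DFunLike.congr_fun (hprod t) x
  rw [mul_apply_eq_comp, mul_apply_eq_comp] at h
  rw [← h] at this
  simpa using this

end DissipativeOperators

/-! ### Semigroups generated by an inverse, and the norm estimate from a form bound. -/

section InverseGenerator

variable {X : Type*} [NormedAddCommGroup X] [InnerProductSpace ℂ X]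

/-- The semigroup `T` has the (possibly unbounded) inverse of the bounded operator `B` as its
generator, expressed by the integrated Cauchy problem. -/
structure C0Semigroup.GeneratedByInverse (T : C0Semigroup X) (B : X →L[ℂ] X) : Prop where
  comm : ∀ t x, T.op t (B x) = B (T.op t x)
  integral : ∀ (t : ℝ≥0) x, T.op t (B x) - B x = ∫ s in (0 : ℝ)..t, T.op s.toNNReal x

namespace C0Semigroup

theorem continuous_real (T : C0Semigroup X) (x : X) :
    Continuous fun s : ℝ => T.op s.toNNReal x :=
  (T.continuous_orbit x).comp continuous_real_toNNReal

theorem tendsto_smul_of_hasDerivWithinAt {f : ℝ → X} {f' : X}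
    (h : HasDerivWithinAt f f' (Set.Ioi 0) 0) :
    Tendsto (fun t : ℝ≥0 => (((t : ℝ) : ℂ))⁻¹ • (f t - f 0)) (𝓝[>] 0) (𝓝 f') := by
  rw [hasDerivWithinAt_iff_tendsto_slope' Set.self_notMem_Ioi] at h
  have hc : Tendsto (fun t : ℝ≥0 => (t : ℝ)) (𝓝[>] 0) (𝓝[>] 0) := by
    refine tendsto_nhdsWithin_iff.mpr ⟨?_, ?_⟩
    · exact (NNReal.continuous_coe.tendsto 0).mono_left nhdsWithin_le_nhds
    · filter_upwards [self_mem_nhdsWithin] with t ht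
      exact NNReal.coe_pos.mpr ht
  refine (h.comp hc).congr fun t => ?_
  rw [Function.comp_apply, slope_def_module, sub_zero, ← Complex.ofReal_inv, Complex.coe_smul]

end C0Semigroup

variable [CompleteSpace X]

namespace C0Semigroup

theorem GeneratedByInverse.hasDerivAt {T : C0Semigroup X} {B : X →L[ℂ] X}
    (h : T.GeneratedByInverse B) (x : X) {t : ℝ} (ht : 0 < t) :
    HasDerivAt (fun s : ℝ => T.op s.toNNReal (B x)) (T.op t.toNNReal x) t := by
  have h1 : HasDerivAt (fun s : ℝ => B x + ∫ r in (0 : ℝ)..s, T.op r.toNNReal x)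
      (T.op t.toNNReal x) t :=
    ((T.continuous_real x).integral_hasStrictDerivAt 0 t).hasDerivAt.const_add _
  refine h1.congr_of_eventuallyEq ?_
  filter_upwards [lt_mem_nhds ht] with s hs
  have := h.integral s.toNNReal x
  rw [Real.coe_toNNReal s hs.le] at this
  rw [← this, add_sub_cancel]

theorem GeneratedByInverse.tendsto {T : C0Semigroup X} {B : X →L[ℂ] X}
    (h : T.GeneratedByInverse B) (x : X) :
    Tendsto (fun t : ℝ≥0 => (((t : ℝ) : ℂ))⁻¹ • (T.op t (B x) - B x)) (𝓝[>] 0) (𝓝 x) := by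
  have h1 : HasDerivAt (fun s : ℝ => ∫ r in (0 : ℝ)..s, T.op r.toNNReal x) x 0 := by
    simpa [T.op_zero] using ((T.continuous_real x).integral_hasStrictDerivAt 0 0).hasDerivAt
  refine (tendsto_smul_of_hasDerivWithinAt h1.hasDerivWithinAt).congr fun t => ?_
  rw [h.integral, intervalIntegral.integral_same, sub_zero]

theorem GeneratedByInverse.hasGenerator {T : C0Semigroup X} {B : X →L[ℂ] X}
    (h : T.GeneratedByInverse B) {A : X →ₗ.[ℂ] X} (hA : ∀ x y, (x, y) ∈ A.graph ↔ x = B y) :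
    T.HasGenerator A := by
  intro x y
  rw [hA]
  refine ⟨?_, fun hy => ?_⟩
  · rintro rfl
    exact h.tendsto y
  · have h1 := (B.continuous.tendsto y).comp hy
    refine tendsto_nhds_unique (h.tendsto x) (h1.congr fun t => ?_)
    simp [h.comm]

theorem HasGenerator.generatedByInverse {T : C0Semigroup X} {B : X →L[ℂ] X} {A : X →ₗ.[ℂ] X}
    (hT : T.HasGenerator A) (hA : ∀ x y, (x, y) ∈ A.graph ↔ x = B y) :
    T.GeneratedByInverse B := by
  have h0 : ∀ y, Tendsto (fun t : ℝ≥0 => (((t : ℝ) : ℂ))⁻¹ • (T.op t (B y) - B y)) (𝓝[>] 0)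
      (𝓝 y) := fun y => (hT _ _).mp ((hA _ _).mpr rfl)
  have hs : ∀ (s : ℝ≥0) y, Tendsto
      (fun t : ℝ≥0 => (((t : ℝ) : ℂ))⁻¹ • (T.op (s + t) (B y) - T.op s (B y))) (𝓝[>] 0)
      (𝓝 (T.op s y)) := by
    intro s y
    refine (((T.op s).continuous.tendsto y).comp (h0 y)).congr fun t => ?_
    simp [T.op_add]
  refine ⟨fun s y => ?_, fun t y => ?_⟩
  -- The semigroup maps the domain of the generator into itself: the quotient at `s` is also the
  -- quotient at 0 of the orbit through T(s)By.
  · refine (hA _ _).mp ((hT _ _).mpr ((hs s y).congr fun t => ?_))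
    rw [add_comm, T.op_add]
    rfl
  · have hd : ∀ s ∈ Set.Ioo (min 0 (t : ℝ)) (max 0 (t : ℝ)), HasDerivWithinAt
        (fun s : ℝ => T.op s.toNNReal (B y)) (T.op s.toNNReal y) (Set.Ioi s) s := by
      intro s hst
      rw [min_eq_left t.coe_nonneg] at hst
      have hs0 : 0 ≤ s := hst.1.le
      rw [hasDerivWithinAt_iff_tendsto_slope' Set.self_notMem_Ioi]
      have hc : Tendsto (fun r : ℝ => (r - s).toNNReal) (𝓝[>] s) (𝓝[>] 0) := by
        refine tendsto_nhdsWithin_iff.mpr ⟨?_, ?_⟩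
        · have : Continuous fun r : ℝ => (r - s).toNNReal :=
            continuous_real_toNNReal.comp (continuous_id.sub continuous_const)
          have := this.tendsto s
          simp only [sub_self, Real.toNNReal_zero] at this
          exact this.mono_left nhdsWithin_le_nhds
        · filter_upwards [self_mem_nhdsWithin] with r hr
          exact Real.toNNReal_pos.mpr (sub_pos.mpr hr)
      refine ((hs s.toNNReal y).comp hc).congr' ?_
      filter_upwards [self_mem_nhdsWithin] with r hr
      have hr' : 0 ≤ r - s := (sub_pos.mpr hr).le
      rw [Function.comp_apply, ← Real.toNNReal_add hs0 hr', add_sub_cancel,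
        Real.coe_toNNReal _ hr', slope_def_module, ← Complex.ofReal_inv, Complex.coe_smul]
    have := intervalIntegral.integral_eq_sub_of_hasDeriv_right
      (T.continuous_real (B y)).continuousOn hd
      ((T.continuous_real y).intervalIntegrable _ _)
    rw [this]
    simp [T.op_zero]

theorem re_inner_sub_le_of_forall_form_bound {T S : C0Semigroup X} {B G : X →L[ℂ] X}
    (hT : T.GeneratedByInverse B) (hS : S.GeneratedByInverse G) {ε : ℝ}
    (hε : 0 ≤ ε) (hb : ∀ u v, (⟪u, B v⟫_ℂ).re - (⟪G u, v⟫_ℂ).re ≤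
      ε / 2 * (-(⟪u, G u⟫_ℂ).re - (⟪v, B v⟫_ℂ).re)) (t : ℝ≥0) (u v : X) :
    (⟪S.op t (G u), B v⟫_ℂ).re - (⟪G u, T.op t (B v)⟫_ℂ).re ≤
      ε / 4 * (‖G u‖ ^ 2 + ‖B v‖ ^ 2) := by
  have nsq : ∀ x : X, ‖x‖ ^ 2 = (⟪x, x⟫_ℂ).re := fun x => by
    rw [inner_self_eq_norm_sq_to_K]
    simp only [Complex.coe_algebraMap, ← Complex.ofReal_pow, Complex.ofReal_re]
  let F : ℝ → X := fun s => S.op s.toNNReal (G u)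
  let K : ℝ → X := fun s => T.op (t - s).toNNReal (B v)
  have hFd : ∀ s ∈ Set.Ioo 0 (t : ℝ), HasDerivAt F (S.op s.toNNReal u) s :=
    fun s hs => hS.hasDerivAt u hs.1
  have hKd : ∀ s ∈ Set.Ioo 0 (t : ℝ), HasDerivAt K (-T.op (t - s).toNNReal v) s := by
    intro s hs
    have := HasDerivAt.scomp s (hT.hasDerivAt v (sub_pos.mpr hs.2))
      ((hasDerivAt_id s).const_sub (t : ℝ))
    simpa using! this
  have hFc : Continuous F := S.continuous_real _
  have hKc : Continuous K :=
    (T.continuous_real _).comp (continuous_const.sub continuous_id)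
  -- The squared norms absorb the AM-GM bound exactly; `ε / 4` appears because differentiating a
  -- squared norm produces a factor 2.
  let g : ℝ → ℝ := fun s => (⟪F s, K s⟫_ℂ).re +
    (ε / 4 * (⟪F s, F s⟫_ℂ).re - ε / 4 * (⟪K s, K s⟫_ℂ).re)
  have hgd := fun s (hs : s ∈ Set.Ioo 0 (t : ℝ)) =>
    (hasDerivAt_re_inner (hFd s hs) (hKd s hs)).add
    (((hasDerivAt_re_inner (hFd s hs) (hFd s hs)).const_mul (ε / 4)).sub
    ((hasDerivAt_re_inner (hKd s hs) (hKd s hs)).const_mul (ε / 4)))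
  have hg : AntitoneOn g (Set.Icc 0 t) := by
    refine antitoneOn_of_deriv_nonpos (convex_Icc _ _) ?_ ?_ ?_
    · refine Continuous.continuousOn ?_
      have := Complex.continuous_re
      fun_prop
    · rw [interior_Icc]
      exact fun s hs => (hgd s hs).differentiableAt.differentiableWithinAt
    · rw [interior_Icc]
      intro s hs
      refine (hgd s hs).deriv.trans_le ?_
      have h1 := hb (S.op s.toNNReal u) (T.op (t - s).toNNReal v)
      have e1 : F s = G (S.op s.toNNReal u) := hS.comm _ _
      have e2 : K s = B (T.op (t - s).toNNReal v) := hT.comm _ _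
      have sw : ∀ x y : X, (⟪x, y⟫_ℂ).re = (⟪y, x⟫_ℂ).re := fun x y => by
        rw [← inner_conj_symm, Complex.conj_re]
      rw [e1, e2, sw (G (S.op s.toNNReal u)) (S.op s.toNNReal u)]
      simp only [inner_neg_left, inner_neg_right, Complex.neg_re]
      rw [sw (B (T.op (t - s).toNNReal v)) (T.op (t - s).toNNReal v)]
      linarith
  have := hg (Set.left_mem_Icc.mpr t.2) (Set.right_mem_Icc.mpr t.2) t.2
  simp only [g, F, K, ← nsq, sub_zero, sub_self, Real.toNNReal_zero, Real.toNNReal_coe, T.op_zero,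
    S.op_zero, one_apply_eq_self] at this
  nlinarith [mul_nonneg hε (sq_nonneg ‖S.op t (G u)‖), mul_nonneg hε (sq_nonneg ‖T.op t (B v)‖)]

end C0Semigroup

omit [CompleteSpace X] in
theorem ContinuousLinearMap.opNorm_le_of_re_inner_le_sq_add_sq {L : X →L[ℂ] X} {c : ℝ} (hc : 0 ≤ c)
    (h : ∀ x y, (⟪x, L y⟫_ℂ).re ≤ c / 2 * (‖x‖ ^ 2 + ‖y‖ ^ 2)) : ‖L‖ ≤ c := by
  refine L.opNorm_le_bound hc fun y => ?_
  rcases eq_or_ne (L y) 0 with h0 | h0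
  · rw [h0, norm_zero]
    positivity
  have hL : 0 < ‖L y‖ := norm_pos_iff.mpr h0
  have hy : 0 < ‖y‖ := norm_pos_iff.mpr fun h => h0 (by simp [h])
  -- The test vector has norm ‖y‖, where the arithmetic mean equals the geometric one.
  have := h (((‖y‖ / ‖L y‖ : ℝ) : ℂ) • L y) y
  rw [inner_smul_left, inner_self_eq_norm_sq_to_K, norm_smul, Complex.norm_real,
    Real.norm_of_nonneg (by positivity), div_mul_cancel₀ _ hL.ne'] at this
  simp only [Complex.conj_ofReal, Complex.coe_algebraMap, ← Complex.ofReal_pow,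
    ← Complex.ofReal_mul, Complex.ofReal_re] at this
  have e : ‖y‖ / ‖L y‖ * ‖L y‖ ^ 2 = ‖y‖ * ‖L y‖ := by field_simp
  nlinarith

namespace C0Semigroup

theorem norm_adjoint_sub_le_of_forall_form_bound {T S : C0Semigroup X} {B G : X →L[ℂ] X}
    (hT : T.GeneratedByInverse B) (hS : S.GeneratedByInverse G) (hB : DenseRange B)
    (hG : DenseRange G) {ε : ℝ} (hε : 0 ≤ ε)
    (hb : ∀ u v, (⟪u, B v⟫_ℂ).re - (⟪G u, v⟫_ℂ).re ≤
      ε / 2 * (-(⟪u, G u⟫_ℂ).re - (⟪v, B v⟫_ℂ).re)) (t : ℝ≥0) :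
    ‖ContinuousLinearMap.adjoint (S.op t) - T.op t‖ ≤ ε / 2 := by
  refine ContinuousLinearMap.opNorm_le_of_re_inner_le_sq_add_sq (by positivity) fun x y => ?_
  rw [sub_apply, inner_sub_right, ContinuousLinearMap.adjoint_inner_right, Complex.sub_re]
  have := Complex.continuous_re
  refine hG.induction_on x (isClosed_le (by fun_prop) (by fun_prop)) fun u => ?_
  refine hB.induction_on y (isClosed_le (by fun_prop) (by fun_prop)) fun v => ?_
  refine (re_inner_sub_le_of_forall_form_bound hT hS hε hb t u v).trans_eq ?_
  ring

/-- This is the norm estimate with ε = 0: the form difference vanishes when the second operator is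
the adjoint of the first. -/
theorem GeneratedByInverse.adjoint_eq {T S : C0Semigroup X} {B : X →L[ℂ] X}
    (hT : T.GeneratedByInverse B) (hS : S.GeneratedByInverse (ContinuousLinearMap.adjoint B))
    (hB : DenseRange B) (hG : DenseRange (ContinuousLinearMap.adjoint B)) (t : ℝ≥0) :
    ContinuousLinearMap.adjoint (S.op t) = T.op t := by
  have := norm_adjoint_sub_le_of_forall_form_bound hT hS hB hG le_rfl (fun u v => by
    rw [ContinuousLinearMap.adjoint_inner_left]; simp) t
  rw [zero_div, norm_le_zero_iff, sub_eq_zero] at this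
  exact this

end C0Semigroup

end InverseGenerator

/-! ### Generation of a contraction semigroup by Yosida approximation. -/

section Generation

variable {X : Type*} [NormedAddCommGroup X] [InnerProductSpace ℂ X] [CompleteSpace X]

/-- The parameter `1 / (n + 1)` of the `n`-th Yosida approximation. -/
def yosidaParam (n : ℕ) : ℝ := 1 / ((n : ℝ) + 1)

theorem yosidaParam_pos (n : ℕ) : 0 < yosidaParam n := Nat.one_div_pos_of_nat

theorem tendsto_yosidaParam : Tendsto yosidaParam atTop (𝓝 0) :=
  tendsto_one_div_add_atTop_nhds_zero_nat

/-- The semigroup generated by the `n`-th Yosida approximation of `B⁻¹`. -/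
def yosidaExp (B : X →L[ℂ] X) (n : ℕ) (t : ℝ) : X →L[ℂ] X :=
  NormedSpace.exp ((t : ℂ) • yosida B (yosidaParam n))

theorem hasDerivAt_yosidaExp (B : X →L[ℂ] X) (n : ℕ) (x : X) (t : ℝ) :
    HasDerivAt (fun s => yosidaExp B n s x)
      (yosidaExp B n t (yosida B (yosidaParam n) x)) t :=
  hasDerivAt_exp_apply _ _ _

theorem continuous_yosidaExp (B : X →L[ℂ] X) (n : ℕ) (x : X) :
    Continuous fun s => yosidaExp B n s x :=
  continuous_iff_continuousAt.mpr fun t => (hasDerivAt_yosidaExp B n x t).continuousAt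

theorem yosidaExp_add (B : X →L[ℂ] X) (n : ℕ) (s t : ℝ) (x : X) :
    yosidaExp B n (s + t) x = yosidaExp B n s (yosidaExp B n t x) := by
  let _ : NormedAlgebra ℚ (X →L[ℂ] X) := NormedAlgebra.restrictScalars ℚ ℂ (X →L[ℂ] X)
  have : yosidaExp B n (s + t) = yosidaExp B n s * yosidaExp B n t := by
    rw [yosidaExp, yosidaExp, yosidaExp, ← NormedSpace.exp_add_of_commute
      (((Commute.refl _).smul_left _).smul_right _), ← add_smul, Complex.ofReal_add]
  rw [this, mul_apply_eq_comp]

namespace DissipativeCLM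

variable {B : X →L[ℂ] X} (hB : DissipativeCLM B)
include hB

theorem norm_yosidaExp_apply_le (n : ℕ) {t : ℝ} (ht : 0 ≤ t) (x : X) :
    ‖yosidaExp B n t x‖ ≤ ‖x‖ :=
  (hB.dissipative_yosida (yosidaParam_pos n)).norm_exp_apply_le ht x

theorem dist_yosidaExp_le (n m : ℕ) {t : ℝ} (ht : 0 ≤ t) (x : X) :
    dist (yosidaExp B n t (B (B x))) (yosidaExp B m t (B (B x))) ≤
      2 * (yosidaParam n + yosidaParam m) * ‖x‖ * t := by
  rw [dist_eq_norm]
  refine ((hB.dissipative_yosida (yosidaParam_pos n)).norm_exp_sub_le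
    (hB.dissipative_yosida (yosidaParam_pos m)) (commute_yosida_yosida B _ _) ht _).trans ?_
  gcongr
  have h1 := hB.norm_yosida_sub_le (yosidaParam_pos n) x
  have h2 := hB.norm_yosida_sub_le (yosidaParam_pos m) x
  have h3 := norm_sub_le_norm_sub_add_norm_sub (yosida B (yosidaParam n) (B (B x))) (B x)
    (yosida B (yosidaParam m) (B (B x)))
  rw [norm_sub_rev (B x)] at h3
  linarith

theorem cauchySeq_yosidaExp (hd : DenseRange B) {t : ℝ} (ht : 0 ≤ t) (x : X) :
    CauchySeq fun n => yosidaExp B n t x := by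
  -- The explicit rate is available only on the range of B²; density and uniform contractivity
  -- extend convergence to every vector.
  have hd2 : DenseRange fun x => B (B x) := hd.comp hd B.continuous
  have hcs : ∀ w, CauchySeq fun n => yosidaExp B n t (B (B w)) := by
    intro w
    refine cauchySeq_of_le_tendsto_0 (fun N => 2 * (yosidaParam N + yosidaParam N) * ‖w‖ * t)
      (fun n m N hn hm => ?_) ?_
    · refine (hB.dist_yosidaExp_le n m ht w).trans ?_
      have h1 : yosidaParam n ≤ yosidaParam N := Nat.one_div_le_one_div hn
      have h2 : yosidaParam m ≤ yosidaParam N := Nat.one_div_le_one_div hm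
      gcongr
    · have := tendsto_yosidaParam
      have := (((this.add this).const_mul 2).mul_const ‖w‖).mul_const t
      simpa using this
  rw [Metric.cauchySeq_iff]
  intro ε hε
  obtain ⟨w, hw⟩ := hd2.exists_dist_lt x (show 0 < ε / 3 by positivity)
  obtain ⟨N, hN⟩ := Metric.cauchySeq_iff.mp (hcs w) (ε / 3) (by positivity)
  have hclose : ∀ n, dist (yosidaExp B n t x) (yosidaExp B n t (B (B w))) < ε / 3 := fun n => by
    rw [dist_eq_norm, ← map_sub]
    exact (hB.norm_yosidaExp_apply_le n ht _).trans_lt (by rwa [← dist_eq_norm])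
  refine ⟨N, fun m hm n hn => ?_⟩
  have h1 := hclose m
  have h2 := hclose n
  have h3 := hN m hm n hn
  have h4 := dist_triangle4 (yosidaExp B m t x) (yosidaExp B m t (B (B w)))
    (yosidaExp B n t (B (B w))) (yosidaExp B n t x)
  rw [dist_comm (yosidaExp B n t (B (B w)))] at h4
  linarith

theorem integral_yosidaExp (n : ℕ) (t : ℝ) (x : X) :
    yosidaExp B n t (B x - (yosidaParam n : ℂ) • x) - (B x - (yosidaParam n : ℂ) • x) =
      ∫ s in (0 : ℝ)..t, yosidaExp B n s x := by
  have h := hB.yosida_apply_sub (yosidaParam_pos n) x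
  rw [intervalIntegral.integral_eq_sub_of_hasDerivAt
    (f := fun s => yosidaExp B n s (B x - (yosidaParam n : ℂ) • x))]
  · simp [yosidaExp]
  · intro s _
    simpa only [h] using hasDerivAt_yosidaExp B n (B x - (yosidaParam n : ℂ) • x) s
  · exact (continuous_yosidaExp B n x).intervalIntegrable _ _

/-- A densely defined inverse of a bounded dissipative operator generates a contraction
semigroup. -/
theorem exists_contractive_generatedByInverse (hd : DenseRange B) :
    ∃ T : C0Semigroup X, T.IsContractive ∧ T.GeneratedByInverse B := by
  have hlim : ∀ (t : ℝ≥0) (x : X), ∃ y, Tendsto (fun n => yosidaExp B n t x) atTop (𝓝 y) :=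
    fun t x => cauchySeq_tendsto_of_complete (hB.cauchySeq_yosidaExp hd t.2 x)
  choose F hF using hlim
  let U : ℝ≥0 → X →L[ℂ] X := fun t =>
    continuousLinearMapOfTendsto (fun n => yosidaExp B n t) (tendsto_pi_nhds.mpr (hF t))
  have hU : ∀ (t : ℝ≥0) x, Tendsto (fun n => yosidaExp B n t x) atTop (𝓝 (U t x)) := hF
  have hUn : ∀ t x, ‖U t x‖ ≤ ‖x‖ := fun t x =>
    le_of_tendsto (hU t x).norm (Eventually.of_forall fun n => hB.norm_yosidaExp_apply_le n t.2 x)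
  have hadd : ∀ s t, U (s + t) = U s ∘L U t := by
    intro s t
    ext x
    refine tendsto_nhds_unique (hU (s + t) x) ?_
    have h1 : Tendsto (fun n => yosidaExp B n s (yosidaExp B n t x - U t x)) atTop (𝓝 0) := by
      refine squeeze_zero_norm (fun n => hB.norm_yosidaExp_apply_le n s.2 _) ?_
      exact tendsto_iff_norm_sub_tendsto_zero.mp (hU t x)
    have h2 := h1.add (hU s (U t x))
    rw [zero_add] at h2
    refine h2.congr fun n => ?_
    rw [map_sub, sub_add_cancel, NNReal.coe_add, yosidaExp_add]
  have hsub : ∀ (t : ℝ≥0) x, Tendsto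
      (fun n => yosidaExp B n t (B x - (yosidaParam n : ℂ) • x) - (B x - (yosidaParam n : ℂ) • x))
      atTop (𝓝 (U t (B x) - B x)) := by
    intro t x
    have hp : Tendsto (fun n => (yosidaParam n : ℂ)) atTop (𝓝 0) := by
      simpa [Function.comp_def] using (Complex.continuous_ofReal.tendsto 0).comp tendsto_yosidaParam
    have h1 := (hp.smul (hU t x))
    have h2 := ((hU t (B x)).sub h1).sub ((tendsto_const_nhds (x := B x)).sub (hp.smul_const x))
    simpa only [map_sub, map_smul, zero_smul, sub_zero] using h2
  -- Orbits through the dense range of B are Lipschitz by the integrated equation; uniform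
  -- approximation then makes every orbit continuous.
  have hlip : ∀ (x : X), LipschitzWith ‖x‖₊ fun t => U t (B x) := by
    refine fun x => LipschitzWith.of_dist_le_mul fun t s => ?_
    rw [dist_eq_norm, ← sub_sub_sub_cancel_right _ _ (B x)]
    refine le_of_tendsto ((hsub t x).sub (hsub s x)).norm (Eventually.of_forall fun n => ?_)
    have hi := fun r => (continuous_yosidaExp B n x).intervalIntegrable
      (μ := MeasureTheory.volume) 0 r
    rw [hB.integral_yosidaExp, hB.integral_yosidaExp,
      intervalIntegral.integral_interval_sub_left (hi _) (hi _)]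
    refine intervalIntegral.norm_integral_le_of_norm_le_const fun r hr => ?_
    refine hB.norm_yosidaExp_apply_le n ?_ x
    exact (le_min s.2 t.2).trans hr.1.le
  have hcont : ∀ x, Continuous fun t => U t x := by
    intro x
    refine continuous_of_uniform_approx_of_continuous fun u hu => ?_
    obtain ⟨ε, hε, hεu⟩ := Metric.mem_uniformity_dist.mp hu
    obtain ⟨w, hw⟩ := hd.exists_dist_lt x hε
    refine ⟨fun t => U t (B w), (hlip w).continuous, fun t => hεu ?_⟩
    rw [dist_eq_norm, ← map_sub]
    exact (hUn t _).trans_lt (by rwa [← dist_eq_norm])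
  refine ⟨⟨U, ?_, hadd, hcont⟩, fun t => ?_, ⟨fun t x => ?_, fun t x => ?_⟩⟩
  · ext x
    refine tendsto_nhds_unique (hU 0 x) ?_
    simp [yosidaExp]
  · exact ContinuousLinearMap.opNorm_le_bound _ zero_le_one fun x => by simpa using hUn t x
  · refine tendsto_nhds_unique (hU t (B x)) (((B.continuous.tendsto _).comp (hU t x)).congr ?_)
    exact fun n => (exp_apply_comm (hB.commute_yosida (yosidaParam_pos n)).symm _ _).symm
  · refine tendsto_nhds_unique (hsub t x) ?_
    simp only [hB.integral_yosidaExp]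
    refine intervalIntegral.tendsto_integral_filter_of_dominated_convergence (fun _ => ‖x‖)
      (Eventually.of_forall fun n => (continuous_yosidaExp B n x).aestronglyMeasurable)
      (Eventually.of_forall fun n => Eventually.of_forall fun s hs => ?_)
      intervalIntegrable_const (Eventually.of_forall fun s hs => ?_)
    all_goals rw [Set.uIoc_of_le t.coe_nonneg] at hs
    · exact hB.norm_yosidaExp_apply_le n hs.1.le x
    · simpa [Real.coe_toNNReal s hs.1.le] using hU s.toNNReal x

end DissipativeCLM

end Generation

/-! ### Kernels and ranges of dissipative operators; the form bound and the norm bound for inverses.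
-/

section InverseOfDissipative

variable {X : Type*} [NormedAddCommGroup X] [InnerProductSpace ℂ X]

namespace DissipativeCLM

/-- Along tx + z the quadratic form is affine in t with slope Re⟨Bz, x⟩; being bounded above, it has
slope zero. -/
theorem inner_apply_eq_zero {B : X →L[ℂ] X} (hB : DissipativeCLM B) {x : X} (hx : B x = 0)
    (z : X) : ⟪B z, x⟫_ℂ = 0 := by
  have key : ∀ z, (⟪B z, x⟫_ℂ).re = 0 := by
    intro z
    have h : ∀ t : ℝ, t * (⟪B z, x⟫_ℂ).re + (⟪B z, z⟫_ℂ).re ≤ 0 := by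
      intro t
      have := hB ((t : ℂ) • x + z)
      rwa [map_add, map_smul, hx, smul_zero, zero_add, inner_add_right, inner_smul_right,
        Complex.add_re, Complex.re_ofReal_mul] at this
    by_contra hr
    have := h ((1 - (⟪B z, z⟫_ℂ).re) / (⟪B z, x⟫_ℂ).re)
    rw [div_mul_cancel₀ _ hr] at this
    linarith
  -- Rotating z by the inner product itself turns the real part into the full squared modulus.
  have h := key ((⟪B z, x⟫_ℂ) • z)
  rw [map_smul, inner_smul_left, ← Complex.normSq_eq_conj_mul_self, Complex.ofReal_re] at h
  exact Complex.normSq_eq_zero.mp h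

variable [CompleteSpace X] {B : X →L[ℂ] X} (hB : DissipativeCLM B)
include hB

theorem adjoint : DissipativeCLM (ContinuousLinearMap.adjoint B) := fun x => by
  rw [ContinuousLinearMap.adjoint_inner_left, ← inner_conj_symm, Complex.conj_re]
  exact hB x

theorem injective_adjoint (hi : Function.Injective B) :
    Function.Injective (ContinuousLinearMap.adjoint B) := by
  refine (injective_iff_map_eq_zero _).mpr fun y hy => ?_
  refine (injective_iff_map_eq_zero _).mp hi y ?_
  refine ext_inner_left ℂ fun z => ?_
  rw [← ContinuousLinearMap.adjoint_inner_left, hB.adjoint.inner_apply_eq_zero hy, inner_zero_right]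

theorem denseRange (hi : Function.Injective B) : DenseRange B := by
  have h : (LinearMap.range B.toLinearMap).topologicalClosure = ⊤ := by
    rw [Submodule.topologicalClosure_eq_top_iff, Submodule.eq_bot_iff]
    intro y hy
    refine (injective_iff_map_eq_zero _).mp (hB.injective_adjoint hi) y ?_
    refine ext_inner_left ℂ fun z => ?_
    rw [ContinuousLinearMap.adjoint_inner_right, inner_zero_right]
    exact (Submodule.mem_orthogonal _ _).mp hy _ ⟨z, rfl⟩
  exact Submodule.dense_iff_topologicalClosure_eq_top.mpr h

end DissipativeCLM

variable [CompleteSpace X]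

open ContinuousLinearMap in
theorem formBoundedPair_of_inverse {A A' : X →ₗ.[ℂ] X} {B B' : X →L[ℂ] X}
    (hA : ∀ x y, (x, y) ∈ A.graph ↔ x = B y) (hA' : ∀ x y, (x, y) ∈ A'.graph ↔ x = B' y)
    (hB : DissipativeCLM B) (hB' : DissipativeCLM B') (hi : Function.Injective B)
    (hi' : Function.Injective B') {ε : ℝ}
    (hb : ∀ u v, ‖⟪u, B v - B' v⟫_ℂ‖ ^ 2 ≤ ε ^ 2 * -(⟪B' u, u⟫_ℂ).re * -(⟪B v, v⟫_ℂ).re)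
    {T T' : C0Semigroup X} (hT : T.HasGenerator A) (hT' : T'.HasGenerator A') :
    FormBoundedPair A A' T T' ε := by
  have hdom' : Dense (A'.domain : Set X) := by
    refine (hB'.denseRange hi').mono ?_
    rintro _ ⟨v, rfl⟩
    exact LinearPMap.mem_domain_of_mem_graph ((hA' _ _).mpr rfl)
  have hval : ∀ y : A.domain, (y : X) = B (A y) := fun y => (hA _ _).mp (A.mem_graph y)
  have hval' : ∀ y : A'.domain, (y : X) = B' (A' y) := fun y => (hA' _ _).mp (A'.mem_graph y)
  have hadj : ∀ u (z : A'.domain), ⟪u, (z : X)⟫_ℂ = ⟪adjoint B' u, A' z⟫_ℂ := by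
    intro u z
    rw [adjoint_inner_left, ← hval']
  -- D and E are the ranges of B'* and B; they are invariant because each semigroup commutes with
  -- the inverse of its generator.
  refine ⟨hT, hT', LinearMap.range (adjoint B').toLinearMap, LinearMap.range B.toLinearMap,
    ?_, ?_, hB'.adjoint.denseRange (hB'.injective_adjoint hi'), hB.denseRange hi, ?_, ?_, ?_⟩
  · rintro _ ⟨u, rfl⟩
    exact LinearPMap.mem_adjoint_domain_of_exists _ ⟨u, hadj u⟩
  · rintro _ ⟨v, rfl⟩
    exact LinearPMap.mem_domain_of_mem_graph ((hA _ _).mpr rfl)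
  · rintro t _ ⟨u, rfl⟩
    refine ⟨adjoint (T'.op t) u, ?_⟩
    refine ext_inner_right ℂ fun z => ?_
    simp only [coe_coe, adjoint_inner_left]
    rw [(hT'.generatedByInverse hA').comm]
  · rintro t _ ⟨v, rfl⟩
    exact ⟨T.op t v, ((hT.generatedByInverse hA).comm t v).symm⟩
  · rintro x ⟨u, hu⟩ y -
    have hx : A'.adjoint x = u := LinearPMap.adjoint_apply_eq hdom' x fun z => by
      rw [← hu]; exact hadj u z
    rw [hx, ← hu, hval y]
    generalize A y = v
    simp only [coe_coe, adjoint_inner_right, adjoint_inner_left, map_neg, inner_neg_left,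
      Complex.neg_re]
    have sw : ∀ x y : X, (⟪x, y⟫_ℂ).re = (⟪y, x⟫_ℂ).re := fun x y => by
      rw [← inner_conj_symm, Complex.conj_re]
    refine ⟨neg_nonneg.mpr (hB' u), neg_nonneg.mpr ((sw _ _).trans_le (hB v)), ?_⟩
    have := hb u v
    rwa [inner_sub_right, sw (B v)] at this

open ContinuousLinearMap in
theorem norm_op_sub_le_of_inverse {A A' : X →ₗ.[ℂ] X} {B B' : X →L[ℂ] X}
    (hA : ∀ x y, (x, y) ∈ A.graph ↔ x = B y) (hA' : ∀ x y, (x, y) ∈ A'.graph ↔ x = B' y)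
    (hB : DissipativeCLM B) (hB' : DissipativeCLM B') (hi : Function.Injective B)
    (hi' : Function.Injective B') {ε : ℝ} (hε : 0 ≤ ε)
    (hb : ∀ u v, ‖⟪u, B v - B' v⟫_ℂ‖ ^ 2 ≤ ε ^ 2 * -(⟪B' u, u⟫_ℂ).re * -(⟪B v, v⟫_ℂ).re)
    {T T' : C0Semigroup X} (hT : T.HasGenerator A) (hT' : T'.HasGenerator A') (t : ℝ≥0) :
    ‖T'.op t - T.op t‖ ≤ ε / 2 := by
  have hd' := hB'.adjoint.denseRange (hB'.injective_adjoint hi')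
  obtain ⟨S, -, hS⟩ := hB'.adjoint.exists_contractive_generatedByInverse hd'
  rw [← (hT'.generatedByInverse hA').adjoint_eq hS (hB'.denseRange hi') hd']
  refine C0Semigroup.norm_adjoint_sub_le_of_forall_form_bound (hT.generatedByInverse hA) hS
    (hB.denseRange hi) hd' hε (fun u v => ?_) t
  rw [adjoint_inner_left, adjoint_inner_right, ← Complex.sub_re, ← inner_sub_right,
    ← inner_conj_symm v, Complex.conj_re]
  set p := -(⟪B' u, u⟫_ℂ).re with hp
  set q := -(⟪B v, v⟫_ℂ).re with hq
  have hp0 : 0 ≤ p := neg_nonneg.mpr (hB' u)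
  have hq0 : 0 ≤ q := neg_nonneg.mpr (hB v)
  refine (Complex.re_le_norm _).trans (le_of_sq_le_sq ((hb u v).trans ?_) (by nlinarith))
  nlinarith [mul_nonneg (sq_nonneg ε) (sq_nonneg (p - q))]

end InverseOfDissipative

/-! ### Restriction to the orthogonal complement of the kernel. -/

section Restriction

variable {H : Type*} [NormedAddCommGroup H] [InnerProductSpace ℂ H]

theorem DissipativeCLM.apply_mem_orthogonal_ker {B : H →L[ℂ] H} (hB : DissipativeCLM B) (x : H) :
    B x ∈ (LinearMap.ker B.toLinearMap)ᗮ := by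
  rw [Submodule.mem_orthogonal']
  exact fun u hu => hB.inner_apply_eq_zero hu x

/-- The restriction of `B` to a subspace that contains its range. -/
def restrictTo (B : H →L[ℂ] H) (K : Submodule ℂ H) (hK : ∀ x, B x ∈ K) : K →L[ℂ] K :=
  (B ∘L K.subtypeL).codRestrict K fun x => hK x

theorem coe_restrictTo (B : H →L[ℂ] H) (K : Submodule ℂ H) (hK : ∀ x, B x ∈ K) (x : K) :
    (restrictTo B K hK x : H) = B x := rfl

theorem injective_restrictTo {B : H →L[ℂ] H} {K : Submodule ℂ H} (hK : ∀ x, B x ∈ K)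
    (hker : K = (LinearMap.ker B.toLinearMap)ᗮ) : Function.Injective (restrictTo B K hK) := by
  refine (injective_iff_map_eq_zero _).mpr fun x hx => ?_
  have h1 : (x : H) ∈ LinearMap.ker B.toLinearMap := congrArg Subtype.val hx
  have h2 : (x : H) ∈ (LinearMap.ker B.toLinearMap)ᗮ := hker ▸ x.2
  exact Subtype.ext (inner_self_eq_zero.mp ((Submodule.mem_orthogonal _ _).mp h2 _ h1))

theorem DissipativeCLM.restrictTo {B : H →L[ℂ] H} (hB : DissipativeCLM B) {K : Submodule ℂ H}
    (hK : ∀ x, B x ∈ K) : DissipativeCLM (restrictTo B K hK) := fun x => hB x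

theorem mem_graph_inverse_partIn {B : H →L[ℂ] H} {K : Submodule ℂ H} (hK : ∀ x, B x ∈ K)
    (hi : Function.Injective (restrictTo B K hK)) (x y : K) :
    (x, y) ∈ (partIn B K).inverse.graph ↔ x = restrictTo B K hK y := by
  have hval : ∀ z : (partIn B K).domain, partIn B K z = restrictTo B K hK z := fun z => rfl
  have hker : LinearMap.ker (partIn B K).toFun = ⊥ := by
    rw [LinearMap.ker_eq_bot']
    intro z hz
    exact Subtype.ext (hi ((hval z).symm.trans (hz.trans (map_zero _).symm)))
  rw [LinearPMap.inverse_graph hker, Submodule.mem_map]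
  constructor
  · rintro ⟨⟨a, b⟩, hab, h⟩
    obtain ⟨z, rfl, rfl⟩ := (LinearPMap.mem_graph_iff _).mp hab
    obtain ⟨rfl, rfl⟩ := Prod.mk.inj h
    exact hval z
  · rintro rfl
    exact ⟨(y, restrictTo B K hK y), (LinearPMap.mem_graph_iff _).mpr ⟨⟨y, hK y⟩, rfl, rfl⟩, rfl⟩

end Restriction

/-! ### Symmetry of the relative form bound. -/

section AccretivePerturbation

variable {Y : Type*} [NormedAddCommGroup Y] [InnerProductSpace ℂ Y]

theorem sq_norm_le_mul_of_forall_re_mul_le {z : ℂ} {p q : ℝ} (hq : 0 ≤ q)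
    (h : ∀ s : ℂ, 2 * (s * z).re ≤ p + ‖s‖ ^ 2 * q) : ‖z‖ ^ 2 ≤ p * q := by
  have h' : ∀ τ : ℝ, 2 * (τ * ‖z‖ ^ 2) ≤ p + τ ^ 2 * ‖z‖ ^ 2 * q := by
    intro τ
    have := h (τ * (starRingEnd ℂ) z)
    rw [mul_assoc, Complex.conj_mul', Complex.re_ofReal_mul, ← Complex.ofReal_pow,
      Complex.ofReal_re, norm_mul, Complex.norm_real, RCLike.norm_conj, mul_pow,
      Real.norm_eq_abs, sq_abs] at this
    exact this
  rcases hq.eq_or_lt with rfl | hq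
  · by_contra hn
    rw [mul_zero, not_le] at hn
    have := h' ((p + 1) / ‖z‖ ^ 2)
    rw [div_mul_cancel₀ _ hn.ne'] at this
    have := h' 0
    simp at this
    linarith
  · have := h' (1 / q)
    have e1 : 2 * (1 / q * ‖z‖ ^ 2) = 2 * (‖z‖ ^ 2 / q) := by ring
    have e2 : (1 / q) ^ 2 * ‖z‖ ^ 2 * q = ‖z‖ ^ 2 / q := by field_simp
    rw [e1, e2] at this
    rw [← div_le_iff₀ hq]
    linarith

theorem re_inner_add_smul (C : Y →L[ℂ] Y) (a b : Y) (r : ℝ) :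
    (⟪C ((r : ℂ) • a + b), (r : ℂ) • a + b⟫_ℂ).re = r ^ 2 * (⟪C a, a⟫_ℂ).re + (⟪C b, b⟫_ℂ).re +
      r * ((⟪C a, b⟫_ℂ).re + (⟪C b, a⟫_ℂ).re) := by
  simp only [map_add, map_smul, inner_add_left, inner_add_right, inner_smul_left,
    inner_smul_right, Complex.conj_ofReal, Complex.add_re, Complex.re_ofReal_mul]
  ring

theorem re_inner_smul_smul (C : Y →L[ℂ] Y) (a : Y) (s : ℂ) :
    (⟪C (s • a), s • a⟫_ℂ).re = ‖s‖ ^ 2 * (⟪C a, a⟫_ℂ).re := by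
  rw [map_smul, inner_smul_left, inner_smul_right, ← mul_assoc, Complex.conj_mul',
    ← Complex.ofReal_pow, Complex.re_ofReal_mul]

/-- The relative form bound between two accretive operators is symmetric in the two operators. -/
theorem accretive_form_bound_swap {C C' : Y →L[ℂ] Y}
    (hC : ∀ x, 0 ≤ (⟪C x, x⟫_ℂ).re) (hC' : ∀ x, 0 ≤ (⟪C' x, x⟫_ℂ).re) {ε : ℝ} (hε : 0 < ε)
    (hbound : ∀ x y, ‖⟪(C' - C) x, y⟫_ℂ‖ ^ 2 ≤ ε ^ 2 * (⟪C y, y⟫_ℂ).re * (⟪C' x, x⟫_ℂ).re)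
    (x y : Y) :
    ‖⟪(C' - C) x, y⟫_ℂ‖ ^ 2 ≤ ε ^ 2 * (⟪C' y, y⟫_ℂ).re * (⟪C x, x⟫_ℂ).re := by
  obtain ⟨k, hk, hεk⟩ : ∃ k, 0 < k ∧ ε ^ 2 = 2 * k := ⟨ε ^ 2 / 2, by positivity, by ring⟩
  rw [hεk] at hbound ⊢
  set W := C' - C with hW
  have hC'W : ∀ a, (⟪C' a, a⟫_ℂ).re = (⟪C a, a⟫_ℂ).re + (⟪W a, a⟫_ℂ).re := fun a => by
    rw [hW, sub_apply, inner_sub_left, Complex.sub_re]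
    ring
  have h1 : ∀ a b, 2 * (⟪W a, b⟫_ℂ).re ≤ 2 * k * (⟪C' a, a⟫_ℂ).re + (⟪C b, b⟫_ℂ).re := by
    intro a b
    have hp := hC' a
    have hq := hC b
    refine le_of_sq_le_sq (le_trans ?_ (four_mul_le_pow_two_add _ _)) (by positivity)
    have := (sq_le_sq.mpr ((Complex.abs_re_le_norm ⟪W a, b⟫_ℂ).trans (le_abs_self _))).trans
      (hbound a b)
    linarith
  have h2 : ∀ a b, 2 * (⟪W a, b⟫_ℂ).re - k * ((⟪C a, b⟫_ℂ).re + (⟪C b, a⟫_ℂ).re) ≤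
      (2 * k + k ^ 2) * (⟪C a, a⟫_ℂ).re + (⟪C b, b⟫_ℂ).re := by
    intro a b
    -- With k = ε²/2 the shift by ka produces 2k Re⟨Wa, a⟩ on the left, cancelling the same term
    -- hidden in C' on the right; only C remains there.
    have := h1 a ((k : ℂ) • a + b)
    rw [re_inner_add_smul, hC'W, inner_add_right, inner_smul_right, Complex.add_re,
      Complex.re_ofReal_mul] at this
    linarith
  have h3 : ∀ a b, 2 * (⟪W a, b⟫_ℂ).re - k * ((⟪C a, b⟫_ℂ).re + (⟪C b, a⟫_ℂ).re) ≤
      (⟪C a, a⟫_ℂ).re + (2 * k + k ^ 2) * (⟪C b, b⟫_ℂ).re := by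
    intro a b
    have hK : 0 < 2 * k + k ^ 2 := by positivity
    obtain ⟨r, hr, hrK⟩ : ∃ r : ℝ, 0 < r ∧ r ^ 2 = 2 * k + k ^ 2 :=
      ⟨√(2 * k + k ^ 2), Real.sqrt_pos.mpr hK, Real.sq_sqrt hK.le⟩
    -- The left side is real bilinear, so this rescaling preserves it while moving the constant from
    -- a to b.
    have := h2 (((r⁻¹ : ℝ) : ℂ) • a) ((r : ℂ) • b)
    simp only [re_inner_smul_smul, Complex.norm_real, Real.norm_eq_abs, sq_abs] at this
    simp only [map_smul, inner_smul_left, inner_smul_right, Complex.conj_ofReal,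
      Complex.re_ofReal_mul, mul_inv_cancel_left₀ hr.ne', inv_mul_cancel_left₀ hr.ne',
      ← hrK] at this
    rw [← hrK]
    rwa [← mul_assoc, ← mul_pow, mul_inv_cancel₀ hr.ne', one_pow, one_mul] at this
  have h4 : ∀ a b, 2 * (⟪W a, b⟫_ℂ).re ≤ (⟪C a, a⟫_ℂ).re + 2 * k * (⟪C' b, b⟫_ℂ).re := by
    intro a b
    -- The shift is undone in the other variable: the cross terms and the k² terms cancel, and 2k
    -- Re⟨Wb, b⟩ restores C' at b.
    have := h3 (((-k : ℝ) : ℂ) • b + a) b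
    rw [re_inner_add_smul] at this
    simp only [map_add, map_smul, inner_add_left, inner_add_right, inner_smul_left,
      inner_smul_right, Complex.conj_ofReal, Complex.add_re, Complex.re_ofReal_mul] at this
    rw [hC'W]
    linarith
  have := sq_norm_le_mul_of_forall_re_mul_le (z := ⟪W x, y⟫_ℂ) (p := (⟪C x, x⟫_ℂ).re)
    (q := 2 * k * (⟪C' y, y⟫_ℂ).re) (mul_nonneg (by positivity) (hC' y)) fun s => by
      have := h4 x (s • y)
      rw [re_inner_smul_smul, inner_smul_right] at this
      linarith
  linarith

end AccretivePerturbation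

/-! ### The phase space operators. -/

section PhaseSpace

variable {Y : Type*} [NormedAddCommGroup Y] [InnerProductSpace ℂ Y] [CompleteSpace Y]

theorem phaseOp_fst (M C : Y →L[ℂ] Y) (v : WithLp 2 (Y × Y)) :
    (phaseOp M C v).fst = -C v.fst - CFC.sqrt M v.snd := by
  simp [phaseOp, blockOp, sub_eq_add_neg]

theorem phaseOp_snd (M C : Y →L[ℂ] Y) (v : WithLp 2 (Y × Y)) :
    (phaseOp M C v).snd = CFC.sqrt M v.fst := by
  simp [phaseOp, blockOp]

theorem re_inner_phaseOp (M C : Y →L[ℂ] Y) (v : WithLp 2 (Y × Y)) :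
    (⟪phaseOp M C v, v⟫_ℂ).re = -(⟪C v.fst, v.fst⟫_ℂ).re := by
  have hs : ContinuousLinearMap.adjoint (CFC.sqrt M) = CFC.sqrt M :=
    (CFC.sqrt_nonneg M).isSelfAdjoint
  have h : ⟪CFC.sqrt M v.fst, v.snd⟫_ℂ = ⟪v.fst, CFC.sqrt M v.snd⟫_ℂ := by
    conv_lhs => rw [← hs]
    rw [ContinuousLinearMap.adjoint_inner_left]
  rw [WithLp.prod_inner_apply]
  change (⟪(phaseOp M C v).fst, v.fst⟫_ℂ + ⟪(phaseOp M C v).snd, v.snd⟫_ℂ).re = _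
  rw [phaseOp_fst, phaseOp_snd, h, ← inner_conj_symm v.fst (CFC.sqrt M v.snd), inner_sub_left,
    inner_neg_left, Complex.add_re, Complex.sub_re, Complex.neg_re, Complex.conj_re]
  ring

theorem inner_phaseOp_sub_phaseOp (M C C' : Y →L[ℂ] Y) (u v : WithLp 2 (Y × Y)) :
    ⟪u, phaseOp M C v - phaseOp M C' v⟫_ℂ = ⟪u.fst, (C' - C) v.fst⟫_ℂ := by
  rw [WithLp.prod_inner_apply]
  change ⟪u.fst, (phaseOp M C v).fst - (phaseOp M C' v).fst⟫_ℂ +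
    ⟪u.snd, (phaseOp M C v).snd - (phaseOp M C' v).snd⟫_ℂ = _
  simp only [phaseOp_fst, phaseOp_snd, sub_self, inner_zero_right, add_zero]
  congr 1
  rw [sub_apply]
  abel

theorem dissipative_phaseOp (M : Y →L[ℂ] Y) {C : Y →L[ℂ] Y}
    (hC : ∀ x, 0 ≤ (⟪C x, x⟫_ℂ).re) : DissipativeCLM (phaseOp M C) := fun v => by
  rw [re_inner_phaseOp]
  exact neg_nonpos.mpr (hC _)

/-- A kernel vector has no dissipation in its first component, so the bound forces C and C' to agree
there, and hence both phase operators agree on the vector. -/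
theorem ker_phaseOp_le_of_form_bound (M : Y →L[ℂ] Y) {C C' : Y →L[ℂ] Y} {ε : ℝ}
    (hbound : ∀ x y, ‖⟪(C' - C) x, y⟫_ℂ‖ ^ 2 ≤ ε ^ 2 * (⟪C' y, y⟫_ℂ).re * (⟪C x, x⟫_ℂ).re) :
    LinearMap.ker (phaseOp M C).toLinearMap ≤ LinearMap.ker (phaseOp M C').toLinearMap := by
  intro v hv
  have hv0 : phaseOp M C v = 0 := hv
  have h0 : (⟪C v.fst, v.fst⟫_ℂ).re = 0 := by
    have := re_inner_phaseOp M C v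
    rw [hv0, inner_zero_left, Complex.zero_re] at this
    linarith
  have hz : (C' - C) v.fst = 0 := by
    have := hbound v.fst ((C' - C) v.fst)
    rw [h0, mul_zero] at this
    have := pow_eq_zero_iff (two_ne_zero) |>.mp (le_antisymm this (sq_nonneg _))
    exact inner_self_eq_zero.mp (norm_eq_zero.mp this)
  have hsub : phaseOp M C v - phaseOp M C' v = 0 := by
    refine ext_inner_left ℂ fun u => ?_
    rw [inner_phaseOp_sub_phaseOp, hz, inner_zero_right, inner_zero_right]
  rw [hv0, zero_sub, neg_eq_zero] at hsub
  exact hsub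

end PhaseSpace

end

theorem theorem3 {Y : Type*} [NormedAddCommGroup Y] [InnerProductSpace ℂ Y] [CompleteSpace Y]
    (M C C' : Y →L[ℂ] Y) (hM : M.IsPositive)
    (hC : ∀ x, 0 ≤ (⟪C x, x⟫_ℂ).re) (hC' : ∀ x, 0 ≤ (⟪C' x, x⟫_ℂ).re)
    (ε : ℝ) (hε : 0 < ε)
    (hbound : ∀ x y, ‖⟪(C' - C) x, y⟫_ℂ‖ ^ 2 ≤ ε ^ 2 * (⟪C y, y⟫_ℂ).re * (⟪C' x, x⟫_ℂ).re) :
    LinearMap.ker (phaseOp M C).toLinearMap = LinearMap.ker (phaseOp M C').toLinearMap ∧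
    (∃ T : C0Semigroup (physSpace M C),
      T.IsContractive ∧ T.HasGenerator (phaseGen M C (physSpace M C))) ∧
    (∃ T' : C0Semigroup (physSpace M C),
      T'.IsContractive ∧ T'.HasGenerator (phaseGen M C' (physSpace M C))) ∧
    ∀ T T' : C0Semigroup (physSpace M C),
      T.HasGenerator (phaseGen M C (physSpace M C)) →
      T'.HasGenerator (phaseGen M C' (physSpace M C)) →
      FormBoundedPair (phaseGen M C (physSpace M C)) (phaseGen M C' (physSpace M C)) T T' ε ∧
      ∀ t : ℝ≥0, ‖T'.op t - T.op t‖ ≤ ε / 2 := by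
  have hswap := accretive_form_bound_swap hC hC' hε hbound
  have hker : LinearMap.ker (phaseOp M C).toLinearMap =
      LinearMap.ker (phaseOp M C').toLinearMap := by
    -- One inclusion needs the swapped bound, the other the original bound up to sign.
    refine le_antisymm (ker_phaseOp_le_of_form_bound M hswap)
      (ker_phaseOp_le_of_form_bound M (ε := ε) fun x y => ?_)
    rw [← neg_sub C' C, neg_apply, inner_neg_left, norm_neg]
    exact hbound x y
  have hd := dissipative_phaseOp M hC
  have hd' := dissipative_phaseOp M hC'
  have hK' : physSpace M C = (LinearMap.ker (phaseOp M C').toLinearMap)ᗮ := by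
    rw [← hker]
  have hmem : ∀ x, phaseOp M C x ∈ physSpace M C := hd.apply_mem_orthogonal_ker
  have hmem' : ∀ x, phaseOp M C' x ∈ physSpace M C := hK' ▸ hd'.apply_mem_orthogonal_ker
  have hi := injective_restrictTo hmem rfl
  have hi' := injective_restrictTo hmem' hK'
  have hg := mem_graph_inverse_partIn hmem hi
  have hg' := mem_graph_inverse_partIn hmem' hi'
  have hr := hd.restrictTo hmem
  have hr' := hd'.restrictTo hmem'
  have hb : ∀ u v : physSpace M C,
      ‖⟪u, restrictTo _ _ hmem v - restrictTo _ _ hmem' v⟫_ℂ‖ ^ 2 ≤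
      ε ^ 2 * -(⟪restrictTo _ _ hmem' u, u⟫_ℂ).re * -(⟪restrictTo _ _ hmem v, v⟫_ℂ).re := by
    intro u v
    simp only [Submodule.coe_inner, Submodule.coe_sub, coe_restrictTo, re_inner_phaseOp,
      inner_phaseOp_sub_phaseOp, neg_neg]
    rw [norm_inner_symm]
    exact hswap _ _
  refine ⟨hker, ?_, ?_, fun T T' hT hT' =>
    ⟨formBoundedPair_of_inverse hg hg' hr hr' hi hi' hb hT hT',
      norm_op_sub_le_of_inverse hg hg' hr hr' hi hi' hε.le hb hT hT'⟩⟩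
  · obtain ⟨T, hT, hTB⟩ := hr.exists_contractive_generatedByInverse (hr.denseRange hi)
    exact ⟨T, hT, hTB.hasGenerator hg⟩
  · obtain ⟨T, hT, hTB⟩ := hr'.exists_contractive_generatedByInverse (hr'.denseRange hi')
    exact ⟨T, hT, hTB.hasGenerator hg'⟩
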